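/- Let $n\ge 0$, let $[n]=\{1,\dots,n\}$, and let $D\subseteq [n]\times[n]$ be a diagram, i.e. a set of boxes $(i,j)$ with row $i$ and column $j$ in matrix coordinates; write $D_j=\{i : (i,j)\in D\}$ for its $j$-th column. For subsets $R=\{r_1<\dots<r_k\}$ and $S=\{s_1<\dots<s_k\}$ of $[n]$ of the same size, $R\le S$ means $r_a\le s_a$ for all $a$; for diagrams, $C\le D$ means $C_j\le D_j$ for all $j$ (in particular $|C_j|=|D_j|$). Let $Y$ be the upper-triangular $n\times n$ matrix of variables $y_{ij}$, $i\le j$ (with zeros below the diagonal), and let the group $B$ of invertible upper-triangular complex matrices act on $\mathbb C[Y]=\mathbb C[y_{ij}: i\le j]$ by $f(Y)\cdot b=f(b^{-1}Y)$. The flagged Weyl module of $D$ is $$\mathcal M_D=\mathrm{Span}_{\mathbb C}\Big\{\prod_{j=1}^n\det\big(Y^{C_j}_{D_j}\big) : C\le D\Big\},$$ where $Y^R_S$ is the submatrix of $Y$ with rows $R$ and columns $S$. Its character is $\mathrm{char}(\mathcal M_D)(x_1,\dots,x_n)=\mathrm{tr}\big(\mathrm{diag}(x_1,\dots,x_n):\mathcal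 M_D\to\mathcal M_D\big)$, and its dual character is the polynomial $\chi_D(x)=\mathrm{char}(\mathcal M_D)(x_1^{-1},\dots,x_n^{-1})$, which has non-negative integer coefficients. Let $\theta_D$ be the number of supports of $\chi_D$, i.e. the number of exponents $\alpha\in\mathbb Z_{\ge0}^n$ such that the coefficient of $x^\alpha$ in $\chi_D$ is positive. Define $r_1(D)$, $r_2(D)$, $r_3(D)$ as follows (all indices in $[n]$). * $r_1(D)$ is the number of triples $(i_1,i_2,j)$ with $i_1<i_2$, $(i_1,j)\notin D$, $(i_2,j)\in D$ (configuration (A)). * $r_2(D)$ is the number of tuples $(i_1,i_2,i_3,j_1,j_2)$ with $i_1<i_2<i_3$, $j_1<j_2$, $(i_1,j_1),(i_1,j_2)\notin D$, $(i_2,j_1),(i_2,j_2)\in D$, and exactly one of $(i_3,j_1),(i_3,j_2)$ in $D$ (configuration (B) if it is $(i_3,j_1)$, configuration (B$'$) if it is $(i_3,j_2)$). * $r_3(D)$ is the total number of subdiagrams of the following three kinds, where $i_1<i_2<i_3<i_4$: (C) tuples $(i_1,i_2,i_3,i_4,j_1,j_2)$ with $j_1<j_2$, $(i_1,j_1)\notin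 D$, $(i_2,j_1)\in D$, $(i_3,j_2)\notin D$, $(i_4,j_2)\in D$; (C$'$) tuples $(i_1,i_2,i_3,i_4,j_1,j_2)$ with $j_1<j_2$, $(i_1,j_2)\notin D$, $(i_2,j_2)\in D$, $(i_3,j_1)\notin D$, $(i_4,j_1)\in D$; (C$''$) tuples $(i_1,i_2,i_3,i_4,j)$ with $(i_1,j)\notin D$, $(i_2,j)\in D$, $(i_3,j)\notin D$, $(i_4,j)\in D$. **Theorem.** For every diagram $D$ in $[n]\times[n]$, $$\theta_D\ \ge\ 1+r_1(D)+r_2(D)+r_3(D).$$ -/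

import Mathlib

noncomputable section

namespace FlaggedWeyl

open Finset

/-! ### Diagrams and the Gale order -/

/-- A diagram: a set of boxes `(i, j)` (row `i`, column `j`, matrix coordinates) in the
`n × n` grid. -/
abbrev Diagram (n : ℕ) := Finset (Fin n × Fin n)

variable {n : ℕ}

/-- The `j`-th column of a diagram, as a set of row indices. -/
def col (D : Diagram n) (j : Fin n) : Finset (Fin n) :=
  univ.filter fun i => (i, j) ∈ D

/-- The Gale order: `R` and `S` have the same cardinality `k`, and the `a`-th smallest element
of `R` is at most the `a`-th smallest element of `S` for every `a < k`. -/
def GaleLE (R S : Finset (Fin n)) : Prop :=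
  ∃ h : S.card = R.card, ∀ a : Fin R.card, R.orderEmbOfFin rfl a ≤ S.orderEmbOfFin h a

/-- The column-wise Gale order on diagrams. -/
def DiagramLE (C D : Diagram n) : Prop :=
  ∀ j, GaleLE (col C j) (col D j)

/-- The weight of a diagram: the `i`-th entry is the number of boxes in row `i`. -/
def wt (C : Diagram n) : Fin n →₀ ℕ :=
  Finsupp.equivFunOnFinite.symm fun i => (univ.filter fun j => (i, j) ∈ C).card

/-! ### The polynomial ring `ℂ[Y]` and the action of the Borel group -/

/-- The ring `ℂ[Y]` of polynomials in the variables `y_{ij}`, `i ≤ j`. -/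
abbrev CY (n : ℕ) := MvPolynomial {p : Fin n × Fin n // p.1 ≤ p.2} ℂ

/-- The upper-triangular matrix `Y` of variables. -/
def genericY (n : ℕ) : Matrix (Fin n) (Fin n) (CY n) :=
  Matrix.of fun i j => if h : i ≤ j then MvPolynomial.X ⟨(i, j), h⟩ else 0

/-- The Borel subgroup of invertible upper-triangular complex matrices. -/
def borel (n : ℕ) : Subgroup (GL (Fin n) ℂ) where
  carrier := {b | (b : Matrix (Fin n) (Fin n) ℂ).BlockTriangular id}
  one_mem' := by
    simpa using Matrix.blockTriangular_one
  mul_mem' := by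
    intro a b ha hb
    simpa using Matrix.BlockTriangular.mul ha hb
  inv_mem' := by
    intro b hb
    have := Matrix.blockTriangular_inv_of_blockTriangular (M := (b : Matrix (Fin n) (Fin n) ℂ)) hb
    simpa [Matrix.coe_units_inv] using this

/-- The right action of the Borel group on `ℂ[Y]`: `f(Y) ↦ f(b⁻¹ Y)`. -/
def borelAct (b : borel n) : CY n →ₐ[ℂ] CY n :=
  MvPolynomial.aeval fun p =>
    ((((b⁻¹ : borel n) : GL (Fin n) ℂ).val.map MvPolynomial.C *
      genericY n : Matrix (Fin n) (Fin n) (CY n)) p.1.1 p.1.2)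

/-- The element `diag(x₁, …, xₙ)` of the Borel group. -/
def torus (x : Fin n → ℂˣ) : borel n :=
  ⟨⟨Matrix.diagonal fun i => (x i : ℂ), Matrix.diagonal fun i => ((x i)⁻¹ : ℂˣ),
      by simp [Matrix.diagonal_mul_diagonal], by simp [Matrix.diagonal_mul_diagonal]⟩,
    Matrix.blockTriangular_diagonal _⟩

/-! ### The flagged Weyl module -/

/-- `det (Y_S^R)`: the minor of `Y` with rows `R` and columns `S`, where `|S| = |R|`. -/
def minorY (R S : Finset (Fin n)) (h : S.card = R.card) : CY n :=
  ((genericY n).submatrix (R.orderEmbOfFin rfl) (S.orderEmbOfFin h)).det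

/-- `det (Y_D^C)`, the product over all columns `j` of `det (Y_{D_j}^{C_j})`, for `C ≤ D`. -/
def detY (C D : Diagram n) (h : DiagramLE C D) : CY n :=
  ∏ j, minorY (col C j) (col D j) (h j).fst

/-- The flagged Weyl module `M_D`, the span of the `det (Y_D^C)` over all `C ≤ D`. -/
def weylModule (D : Diagram n) : Submodule ℂ (CY n) :=
  Submodule.span ℂ (Set.range fun C : {C : Diagram n // DiagramLE C D} => detY C.1 D C.2)

/-! ### The torus acts on `M_D`, and each `det (Y_D^C)` is an eigenvector -/

theorem borelAct_genericY (x : Fin n → ℂˣ) (i j : Fin n) :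
    borelAct (torus x) (genericY n i j) =
      MvPolynomial.C (((x i)⁻¹ : ℂˣ) : ℂ) * genericY n i j := by
  by_cases h : i ≤ j
  · have e : (((torus x)⁻¹ : borel n) : GL (Fin n) ℂ).val =
        Matrix.diagonal fun i => (((x i)⁻¹ : ℂˣ) : ℂ) := rfl
    have e2 : genericY n i j = MvPolynomial.X ⟨(i, j), h⟩ := by simp [genericY, h]
    rw [e2, borelAct, MvPolynomial.aeval_X, e, Matrix.diagonal_map (by simp),
      Matrix.diagonal_mul, ← e2]
  · simp [genericY, h]

theorem borelAct_minorY (x : Fin n → ℂˣ) (R S : Finset (Fin n)) (h : S.card = R.card) :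
    borelAct (torus x) (minorY R S h) =
      MvPolynomial.C (∏ i ∈ R, (((x i)⁻¹ : ℂˣ) : ℂ)) * minorY R S h := by
  have key : (borelAct (torus x)).mapMatrix
      ((genericY n).submatrix (R.orderEmbOfFin rfl) (S.orderEmbOfFin h)) =
      Matrix.diagonal (fun a => MvPolynomial.C (((x (R.orderEmbOfFin rfl a))⁻¹ : ℂˣ) : ℂ)) *
        (genericY n).submatrix (R.orderEmbOfFin rfl) (S.orderEmbOfFin h) := by
    ext1 a b
    rw [Matrix.diagonal_mul]
    simpa using borelAct_genericY x _ _
  rw [minorY, AlgHom.map_det, key, Matrix.det_mul, Matrix.det_diagonal, ← map_prod]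
  congr 2
  conv_rhs => rw [← Finset.image_orderEmbOfFin_univ R rfl]
  rw [Finset.prod_image (fun a _ b _ hab => (R.orderEmbOfFin rfl).injective hab)]

theorem prod_col (C : Diagram n) (y : Fin n → ℂ) :
    ∏ j, ∏ i ∈ col C j, y i = ∏ i, y i ^ wt C i := by
  simp only [col, Finset.prod_filter]
  rw [Finset.prod_comm]
  refine Finset.prod_congr rfl fun i _ => ?_
  rw [← Finset.prod_filter, Finset.prod_const]
  rfl

/-- The eigenvalue of `diag(x)` on `det (Y_D^C)` is the product of `x_i⁻¹` over the boxes
of `C`. -/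
theorem borelAct_detY (x : Fin n → ℂˣ) (C D : Diagram n) (h : DiagramLE C D) :
    borelAct (torus x) (detY C D h) =
      (∏ i, (((x i)⁻¹ : ℂˣ) : ℂ) ^ wt C i) • detY C D h := by
  rw [detY, map_prod, ← prod_col C, MvPolynomial.smul_eq_C_mul, map_prod, ← Finset.prod_mul_distrib]
  exact Finset.prod_congr rfl fun j _ => borelAct_minorY x _ _ _

theorem borelAct_mem (D : Diagram n) (x : Fin n → ℂˣ) :
    ∀ f ∈ weylModule D, (borelAct (torus x)).toLinearMap f ∈ weylModule D := by
  intro f hf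
  refine Submodule.span_induction (p := fun f _ => (borelAct (torus x)).toLinearMap f ∈ weylModule D)
    ?_ ?_ ?_ ?_ hf
  · rintro _ ⟨C, rfl⟩
    simp only [AlgHom.toLinearMap_apply]
    rw [borelAct_detY]
    exact Submodule.smul_mem _ _ (Submodule.subset_span ⟨C, rfl⟩)
  · simp
  · intro f g _ _ hf hg
    rw [map_add]
    exact Submodule.add_mem _ hf hg
  · intro a f _ hf
    rw [map_smul]
    exact Submodule.smul_mem _ _ hf

/-! ### The character and the dual character -/

/-- The endomorphism of `M_D` given by `X = diag(x₁, …, xₙ)`. -/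
def torusEnd (D : Diagram n) (x : Fin n → ℂˣ) : weylModule D →ₗ[ℂ] weylModule D :=
  (borelAct (torus x)).toLinearMap.restrict (borelAct_mem D x)

/-- The character of `M_D` at `x`: the trace of `diag(x₁, …, xₙ)` on `M_D`. -/
def char (D : Diagram n) (x : Fin n → ℂˣ) : ℂ :=
  LinearMap.trace ℂ (weylModule D) (torusEnd D x)

/-- The function `x ↦ char (M_D) (x₁⁻¹, …, xₙ⁻¹)` is given by a polynomial with coefficients
in `ℕ`, and only by one. -/
theorem existsUnique_dualCharacter (D : Diagram n) :
    ∃! χ : MvPolynomial (Fin n) ℕ, ∀ x : Fin n → ℂˣ,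
      MvPolynomial.aeval (fun i => (x i : ℂ)) χ = char D x⁻¹ := by
  refine existsUnique_of_exists_of_unique ?_ ?_
  · let v : {C : Diagram n // DiagramLE C D} → weylModule D := fun C =>
      ⟨detY C.1 D C.2, Submodule.subset_span ⟨C, rfl⟩⟩
    have hv : Submodule.span ℂ (Set.range v) = ⊤ := by
      apply Submodule.map_injective_of_injective (weylModule D).injective_subtype
      rw [Submodule.map_span, ← Set.range_comp, Submodule.map_top, Submodule.range_subtype]
      rfl
    obtain ⟨κ, a, ha, hsp, hli⟩ := exists_linearIndependent' ℂ v
    have : Finite κ := Finite.of_injective a ha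
    let _ := Fintype.ofFinite κ
    classical
    let b : Module.Basis κ ℂ (weylModule D) := Module.Basis.mk hli (by rw [hsp, hv])
    refine ⟨∑ k, MvPolynomial.monomial (wt (a k).1) 1, fun x => ?_⟩
    rw [char, LinearMap.trace_eq_matrix_trace ℂ b, Matrix.trace, map_sum]
    refine Finset.sum_congr rfl fun k _ => ?_
    have hk : torusEnd D x⁻¹ (b k) = (∏ i, (x i : ℂ) ^ wt (a k).1 i) • b k := by
      apply Subtype.ext
      have : ((b k : weylModule D) : CY n) = detY (a k).1 D (a k).2 := by simp [b, v]
      simp only [torusEnd, LinearMap.coe_restrict_apply, AlgHom.toLinearMap_apply,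
        Submodule.coe_smul, this]
      rw [borelAct_detY]
      simp
    rw [Matrix.diag_apply, LinearMap.toMatrix_apply, hk]
    simp [MvPolynomial.aeval_monomial, Finsupp.prod_fintype]
  · intro p q hp hq
    apply MvPolynomial.map_injective (Nat.castRingHom ℂ) Nat.cast_injective
    refine MvPolynomial.funext_set (fun _ => {z : ℂ | z ≠ 0}) (fun _ => ?_) fun x hx => ?_
    · exact Set.Finite.infinite_compl (Set.finite_singleton (0 : ℂ))
    · have h := (hp fun i => Units.mk0 (x i) (hx i trivial)).trans
        (hq fun i => Units.mk0 (x i) (hx i trivial)).symm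
      have e : algebraMap ℕ ℂ = Nat.castRingHom ℂ := Subsingleton.elim _ _
      simpa [MvPolynomial.eval_map, MvPolynomial.aeval_def, e] using h

/-- The dual character `χ_D`, the polynomial with `χ_D(x) = char (M_D) (x₁⁻¹, …, xₙ⁻¹)`. -/
def dualCharacter (D : Diagram n) : MvPolynomial (Fin n) ℕ :=
  (existsUnique_dualCharacter D).exists.choose

theorem aeval_dualCharacter (D : Diagram n) (x : Fin n → ℂˣ) :
    MvPolynomial.aeval (fun i => (x i : ℂ)) (dualCharacter D) = char D x⁻¹ :=
  (existsUnique_dualCharacter D).exists.choose_spec x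

/-- `θ_D`: the number of supports of `χ_D`, i.e. of exponents with positive coefficient. -/
def theta (D : Diagram n) : ℕ := (dualCharacter D).support.card

/-! ### Counting configurations -/

/-- Configuration (A): in one column, a blank box above a box of `D`. -/
def IsA (D : Diagram n) (i₁ i₂ j : Fin n) : Prop :=
  i₁ < i₂ ∧ (i₁, j) ∉ D ∧ (i₂, j) ∈ D

/-- Configuration (B): rows `i₁ < i₂ < i₃`, columns `j₁ < j₂`; the first row is blank, the second
row lies in `D`, and of the third row exactly the left box lies in `D`. -/
def IsB (D : Diagram n) (i₁ i₂ i₃ j₁ j₂ : Fin n) : Prop :=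
  i₁ < i₂ ∧ i₂ < i₃ ∧ j₁ < j₂ ∧ (i₁, j₁) ∉ D ∧ (i₁, j₂) ∉ D ∧ (i₂, j₁) ∈ D ∧ (i₂, j₂) ∈ D ∧
    (i₃, j₁) ∈ D ∧ (i₃, j₂) ∉ D

/-- Configuration (B'): as (B), but of the third row exactly the right box lies in `D`. -/
def IsB' (D : Diagram n) (i₁ i₂ i₃ j₁ j₂ : Fin n) : Prop :=
  i₁ < i₂ ∧ i₂ < i₃ ∧ j₁ < j₂ ∧ (i₁, j₁) ∉ D ∧ (i₁, j₂) ∉ D ∧ (i₂, j₁) ∈ D ∧ (i₂, j₂) ∈ D ∧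
    (i₃, j₁) ∉ D ∧ (i₃, j₂) ∈ D

/-- Configuration (C): rows `i₁ < i₂ < i₃ < i₄`, columns `j₁ < j₂`; of the boxes
`(i₁, j₁), (i₂, j₁), (i₃, j₂), (i₄, j₂)` exactly `(i₂, j₁)` and `(i₄, j₂)` lie in `D`. -/
def IsC (D : Diagram n) (i₁ i₂ i₃ i₄ j₁ j₂ : Fin n) : Prop :=
  i₁ < i₂ ∧ i₂ < i₃ ∧ i₃ < i₄ ∧ j₁ < j₂ ∧
    (i₁, j₁) ∉ D ∧ (i₂, j₁) ∈ D ∧ (i₃, j₂) ∉ D ∧ (i₄, j₂) ∈ D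

/-- Configuration (C'): rows `i₁ < i₂ < i₃ < i₄`, columns `j₁ < j₂`; of the boxes
`(i₁, j₂), (i₂, j₂), (i₃, j₁), (i₄, j₁)` exactly `(i₂, j₂)` and `(i₄, j₁)` lie in `D`. -/
def IsC' (D : Diagram n) (i₁ i₂ i₃ i₄ j₁ j₂ : Fin n) : Prop :=
  i₁ < i₂ ∧ i₂ < i₃ ∧ i₃ < i₄ ∧ j₁ < j₂ ∧
    (i₁, j₂) ∉ D ∧ (i₂, j₂) ∈ D ∧ (i₃, j₁) ∉ D ∧ (i₄, j₁) ∈ D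

/-- Configuration (C''): rows `i₁ < i₂ < i₃ < i₄`, one column `j`; of the boxes
`(i₁, j), (i₂, j), (i₃, j), (i₄, j)` exactly `(i₂, j)` and `(i₄, j)` lie in `D`. -/
def IsC'' (D : Diagram n) (i₁ i₂ i₃ i₄ j : Fin n) : Prop :=
  i₁ < i₂ ∧ i₂ < i₃ ∧ i₃ < i₄ ∧ (i₁, j) ∉ D ∧ (i₂, j) ∈ D ∧ (i₃, j) ∉ D ∧ (i₄, j) ∈ D

instance (D : Diagram n) (i₁ i₂ j : Fin n) : Decidable (IsA D i₁ i₂ j) := by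
  unfold IsA; infer_instance

instance (D : Diagram n) (i₁ i₂ i₃ j₁ j₂ : Fin n) : Decidable (IsB D i₁ i₂ i₃ j₁ j₂) := by
  unfold IsB; infer_instance

instance (D : Diagram n) (i₁ i₂ i₃ j₁ j₂ : Fin n) : Decidable (IsB' D i₁ i₂ i₃ j₁ j₂) := by
  unfold IsB'; infer_instance

instance (D : Diagram n) (i₁ i₂ i₃ i₄ j₁ j₂ : Fin n) :
    Decidable (IsC D i₁ i₂ i₃ i₄ j₁ j₂) := by
  unfold IsC; infer_instance

instance (D : Diagram n) (i₁ i₂ i₃ i₄ j₁ j₂ : Fin n) :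
    Decidable (IsC' D i₁ i₂ i₃ i₄ j₁ j₂) := by
  unfold IsC'; infer_instance

instance (D : Diagram n) (i₁ i₂ i₃ i₄ j : Fin n) : Decidable (IsC'' D i₁ i₂ i₃ i₄ j) := by
  unfold IsC''; infer_instance

/-- `r₁(D)`: the number of subdiagrams of `D` equal to (A). -/
def r₁ (D : Diagram n) : ℕ :=
  (univ.filter fun t : Fin n × Fin n × Fin n => IsA D t.1 t.2.1 t.2.2).card

/-- `r₂(D)`: the number of subdiagrams of `D` equal to (B) or (B'). -/
def r₂ (D : Diagram n) : ℕ :=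
  (univ.filter fun t : Fin n × Fin n × Fin n × Fin n × Fin n =>
    IsB D t.1 t.2.1 t.2.2.1 t.2.2.2.1 t.2.2.2.2).card +
  (univ.filter fun t : Fin n × Fin n × Fin n × Fin n × Fin n =>
    IsB' D t.1 t.2.1 t.2.2.1 t.2.2.2.1 t.2.2.2.2).card

/-- `r₃(D)`: the number of subdiagrams of `D` equal to (C), (C') or (C''). -/
def r₃ (D : Diagram n) : ℕ :=
  (univ.filter fun t : Fin n × Fin n × Fin n × Fin n × Fin n × Fin n =>
    IsC D t.1 t.2.1 t.2.2.1 t.2.2.2.1 t.2.2.2.2.1 t.2.2.2.2.2).card +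
  (univ.filter fun t : Fin n × Fin n × Fin n × Fin n × Fin n × Fin n =>
    IsC' D t.1 t.2.1 t.2.2.1 t.2.2.2.1 t.2.2.2.2.1 t.2.2.2.2.2).card +
  (univ.filter fun t : Fin n × Fin n × Fin n × Fin n × Fin n =>
    IsC'' D t.1 t.2.1 t.2.2.1 t.2.2.2.1 t.2.2.2.2).card

end FlaggedWeyl

end

namespace FlaggedWeyl

open Finset

variable {n : ℕ}

/-! ### Criteria for the Gale order -/

/-! Every `C ≤ D` puts `wt C` in the support of the dual character: `detY C D` is a nonzero element
of `M_D`, homogeneous of weight `wt C` (`wt_mem_support_dualCharacter`). So it suffices to find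
enough diagrams with distinct weights, and these are made by moving boxes up within their columns.
Only the displacement `wt C - wt D` matters.

(A) For rows `i₁ < i₂`, let `m` be the number of columns with a blank in `i₁` and a box in `i₂`.
Moving `a` of these boxes, `1 ≤ a ≤ m`, gives `m` displacements; summed over row pairs this is `r₁`.
(B) For `i₁ < i₂ < i₃`, move `a` boxes from `i₃` to `i₁` in columns of `colsFull` and `b` boxes from
`i₂` to `i₁` in columns of `colsMid`. The choices of `(a, b)` are as many as the pairs of such
columns, which account for (B) and (B'). (C) For `i₁ < i₂ < i₃ < i₄`, move `a` boxes from `i₂` to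
`i₁` and `b` boxes from `i₄` to `i₃`. Pairs of columns, ordered either way or equal, account for
(C), (C') and (C'').

The numbers of gaining and losing rows are (1,1), (1,2), (2,2) in the three families and (0,0) for
`D` itself, so the families are disjoint. Within a family the signs recover the rows and the values
recover `a` and `b`. -/

/-- Pigeonhole: if the element of `R` at index `a` exceeded that of `S`, then `f` would inject the
`a + 1` smallest elements of `S` into the `a` elements of `R` below it. -/
theorem galeLE_of_injOn {R S : Finset (Fin n)} (hc : S.card = R.card) (f : Fin n → Fin n)
    (hf : Set.InjOn f S) (hm : ∀ s ∈ S, f s ∈ R) (hle : ∀ s ∈ S, f s ≤ s) : GaleLE R S := by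
  refine ⟨hc, fun a => ?_⟩
  by_contra! hlt
  have hex : ∀ c : Fin R.card, ∃ c' : Fin R.card,
      R.orderEmbOfFin rfl c' = f (S.orderEmbOfFin hc c) := by
    intro c
    have : f (S.orderEmbOfFin hc c) ∈ Set.range (R.orderEmbOfFin rfl) := by
      rw [Finset.range_orderEmbOfFin]
      exact hm _ (Finset.orderEmbOfFin_mem _ _ _)
    exact this
  choose g hg using hex
  have hcard : (Iic a).card ≤ (Iio a).card := by
    refine Finset.card_le_card_of_injOn g (fun c hca => ?_) (fun c _ c' _ hcc => ?_)
    · have hca' : c ≤ a := by simpa using hca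
      have h1 : R.orderEmbOfFin rfl (g c) < R.orderEmbOfFin rfl a := by
        rw [hg]
        exact ((hle _ (Finset.orderEmbOfFin_mem _ _ _)).trans
          ((S.orderEmbOfFin hc).monotone hca')).trans_lt hlt
      simpa using h1
    · have h2 : f (S.orderEmbOfFin hc c) = f (S.orderEmbOfFin hc c') := by
        rw [← hg, ← hg, hcc]
      exact (S.orderEmbOfFin hc).injective
        (hf (Finset.orderEmbOfFin_mem _ _ _) (Finset.orderEmbOfFin_mem _ _ _) h2)
  simp at hcard

/-- `C` arises from `D` by moving boxes upwards within their columns. -/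
def RaisesTo (D C : Diagram n) : Prop :=
  ∀ j, ∃ f : Fin n → Fin n, Set.InjOn f (col D j) ∧ (col D j).image f = col C j ∧
    ∀ s ∈ col D j, f s ≤ s

theorem RaisesTo.refl (D : Diagram n) : RaisesTo D D :=
  fun _ => ⟨id, Set.injOn_id _, image_id, fun _ _ => le_rfl⟩

theorem RaisesTo.trans {D E C : Diagram n} (h₁ : RaisesTo D E) (h₂ : RaisesTo E C) :
    RaisesTo D C := by
  intro j
  obtain ⟨f, hf, hfE, hfle⟩ := h₁ j
  obtain ⟨g, hg, hgC, hgle⟩ := h₂ j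
  have hmem : ∀ s ∈ col D j, f s ∈ col E j := fun s hs => hfE ▸ mem_image_of_mem f hs
  refine ⟨g ∘ f, hg.comp hf hmem, ?_, fun s hs => (hgle _ (hmem s hs)).trans (hfle s hs)⟩
  rw [← image_image, hfE, hgC]

theorem RaisesTo.diagramLE {D C : Diagram n} (h : RaisesTo D C) : DiagramLE C D := by
  intro j
  obtain ⟨f, hf, hfC, hfle⟩ := h j
  exact galeLE_of_injOn (by rw [← hfC, card_image_of_injOn hf]) f hf
    (fun s hs => hfC ▸ mem_image_of_mem f hs) hfle

theorem mem_col {D : Diagram n} {i j : Fin n} : i ∈ col D j ↔ (i, j) ∈ D := by simp [col]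

/-- Moving the boxes in row `i₂` of the columns in `J` up to row `i₁`. -/
theorem exists_raisesTo_move (D : Diagram n) {i₁ i₂ : Fin n} (hi : i₁ < i₂) (J : Finset (Fin n))
    (h₁ : ∀ j ∈ J, (i₁, j) ∉ D) (h₂ : ∀ j ∈ J, (i₂, j) ∈ D) :
    ∃ C : Diagram n, RaisesTo D C ∧
      (∀ i j, (j ∈ J → i ≠ i₁ ∧ i ≠ i₂) → ((i, j) ∈ C ↔ (i, j) ∈ D)) ∧
      ∀ i, (wt C i : ℤ) = wt D i + J.card * ((if i = i₁ then 1 else 0) - if i = i₂ then 1 else 0) := by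
  let C : Diagram n := univ.filter fun p =>
    if p.2 ∈ J then p.1 = i₁ ∨ p.1 ≠ i₂ ∧ p ∈ D else p ∈ D
  have hC : ∀ i j, (i, j) ∈ C ↔ if j ∈ J then i = i₁ ∨ i ≠ i₂ ∧ (i, j) ∈ D else (i, j) ∈ D := by
    intro i j; simp [C]
  refine ⟨C, fun j => ?_, fun i j hij => ?_, fun i => ?_⟩
  · by_cases hj : j ∈ J
    -- Injective on the column because row `i₁` is blank there.
    · refine ⟨fun s => if s = i₂ then i₁ else s, ?_, ?_, ?_⟩
      · intro s hs t ht hst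
        have hs' : (s, j) ∈ D := mem_col.1 hs
        have ht' : (t, j) ∈ D := mem_col.1 ht
        have := h₁ j hj
        dsimp only at hst
        split_ifs at hst with ha hb hb
        · rw [ha, hb]
        · exact absurd (hst ▸ ht') this
        · exact absurd (hst ▸ hs') this
        · exact hst
      · ext i
        rw [mem_image, mem_col, hC, if_pos hj]
        constructor
        · rintro ⟨s, hs, rfl⟩
          split_ifs with hsi
          · exact Or.inl rfl
          · exact Or.inr ⟨hsi, mem_col.1 hs⟩
        · rintro (rfl | ⟨hi2, hiD⟩)
          · exact ⟨i₂, mem_col.2 (h₂ j hj), if_pos rfl⟩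
          · exact ⟨i, mem_col.2 hiD, if_neg hi2⟩
      · intro s _
        dsimp only
        split_ifs with hs
        · exact hs ▸ hi.le
        · exact le_rfl
    · refine ⟨id, Set.injOn_id _, ?_, fun _ _ => le_rfl⟩
      ext i
      rw [image_id, mem_col, mem_col, hC, if_neg hj]
  · rw [hC]
    split_ifs with hj
    · simp [hij hj]
    · rfl
  · have hJ : (J.card : ℤ) = ∑ j, if j ∈ J then 1 else 0 := by simp
    have hw : ∀ E : Diagram n, (wt E i : ℤ) = ∑ j, if (i, j) ∈ E then 1 else 0 := by
      intro E
      simp [wt]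
    rw [hw, hw, hJ, sum_mul, ← sum_add_distrib]
    refine sum_congr rfl fun j _ => ?_
    by_cases hj : j ∈ J
    · have a₁ := h₁ j hj
      have a₂ := h₂ j hj
      by_cases e₁ : i = i₁
      · subst e₁
        simp [hC, hj, a₁, hi.ne]
      · by_cases e₂ : i = i₂
        · subst e₂
          simp [hC, hj, a₂, e₁]
        · simp [hC, hj, e₁, e₂]
    · simp [hC, hj]

/-! ### The supports of the dual character -/

/-- The grading of `ℂ[Y]` in which `y_{ij}` has degree `e_i`. -/
noncomputable abbrev rowWeight (n : ℕ) : {p : Fin n × Fin n // p.1 ≤ p.2} → (Fin n →₀ ℕ) :=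
  fun p => Finsupp.single p.1.1 1

theorem isWeightedHomogeneous_genericY (i j : Fin n) :
    MvPolynomial.IsWeightedHomogeneous (rowWeight n) (genericY n i j) (Finsupp.single i 1) := by
  by_cases h : i ≤ j
  · have : genericY n i j = MvPolynomial.X ⟨(i, j), h⟩ := by simp [genericY, h]
    rw [this]
    exact MvPolynomial.isWeightedHomogeneous_X _ _ _
  · have : genericY n i j = 0 := by simp [genericY, h]
    rw [this]
    exact MvPolynomial.isWeightedHomogeneous_zero _ _ _

/-- Each term of the Leibniz expansion takes one entry from every row of `R`. The transpose puts the
permutation on the column indices, so the row degrees do not depend on it. -/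
theorem isWeightedHomogeneous_minorY (R S : Finset (Fin n)) (h : S.card = R.card) :
    MvPolynomial.IsWeightedHomogeneous (rowWeight n) (minorY R S h)
      (∑ i ∈ R, Finsupp.single i 1) := by
  have hR : ∑ i ∈ R, Finsupp.single i 1 =
      ∑ a : Fin R.card, Finsupp.single (R.orderEmbOfFin rfl a) 1 := by
    conv_lhs => rw [← Finset.image_orderEmbOfFin_univ R rfl]
    rw [Finset.sum_image (fun a _ b _ hab => (R.orderEmbOfFin rfl).injective hab)]
  rw [minorY, ← Matrix.det_transpose, Matrix.det_apply', hR]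
  refine MvPolynomial.IsWeightedHomogeneous.sum _ _ _ fun σ _ => ?_
  have hprod := MvPolynomial.IsWeightedHomogeneous.prod (w := rowWeight n) univ
    (fun a : Fin R.card =>
      genericY n (R.orderEmbOfFin rfl a) (S.orderEmbOfFin h (σ a)))
    (fun a => Finsupp.single (R.orderEmbOfFin rfl a) 1)
    (fun a _ => isWeightedHomogeneous_genericY _ _)
  have := (MvPolynomial.isWeightedHomogeneous_C (rowWeight n)
    (((Equiv.Perm.sign σ : ℤ) : ℂ))).mul hprod
  simpa using this

theorem isWeightedHomogeneous_detY (C D : Diagram n) (h : DiagramLE C D) :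
    MvPolynomial.IsWeightedHomogeneous (rowWeight n) (detY C D h) (wt C) := by
  have hw : wt C = ∑ j, ∑ i ∈ col C j, Finsupp.single i 1 := by
    ext i
    simp [wt, Finsupp.finsetSum_apply, Finsupp.single_apply, mem_col]
  rw [hw]
  exact MvPolynomial.IsWeightedHomogeneous.prod _ _ _
    fun j _ => isWeightedHomogeneous_minorY _ _ _

/-- Setting the variables at the matched positions to 1 and all others to 0 turns the submatrix into
the identity. The Gale inequalities ensure that the matched positions carry variables rather than
the zeros below the diagonal of `Y`. -/
theorem minorY_ne_zero {R S : Finset (Fin n)} (h : GaleLE R S) : minorY R S h.fst ≠ 0 := by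
  obtain ⟨hc, hle⟩ := h
  intro h0
  let φ : CY n →ₐ[ℂ] ℂ := MvPolynomial.aeval fun p =>
    if ∃ c, R.orderEmbOfFin rfl c = p.1.1 ∧ S.orderEmbOfFin hc c = p.1.2 then 1 else 0
  have key : φ.mapMatrix
      ((genericY n).submatrix (R.orderEmbOfFin rfl) (S.orderEmbOfFin hc)) = 1 := by
    ext a b
    rw [AlgHom.mapMatrix_apply, Matrix.map_apply, Matrix.submatrix_apply]
    by_cases hab : a = b
    · subst hab
      have : genericY n (R.orderEmbOfFin rfl a) (S.orderEmbOfFin hc a) =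
          MvPolynomial.X ⟨(_, _), hle a⟩ := by simp [genericY, hle a]
      rw [this, MvPolynomial.aeval_X, if_pos ⟨a, rfl, rfl⟩, Matrix.one_apply_eq]
    · rw [Matrix.one_apply_ne hab]
      by_cases hl : R.orderEmbOfFin rfl a ≤ S.orderEmbOfFin hc b
      · have : genericY n (R.orderEmbOfFin rfl a) (S.orderEmbOfFin hc b) =
          MvPolynomial.X ⟨(_, _), hl⟩ := by simp [genericY, hl]
        rw [this, MvPolynomial.aeval_X, if_neg]
        rintro ⟨c, hca, hcb⟩
        exact hab (((R.orderEmbOfFin rfl).injective hca).symm.trans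
          ((S.orderEmbOfFin hc).injective hcb))
      · have : genericY n (R.orderEmbOfFin rfl a) (S.orderEmbOfFin hc b) = 0 := by
          simp [genericY, hl]
        rw [this, map_zero]
  have h1 : φ (minorY R S hc) = 1 := by
    rw [minorY, AlgHom.map_det, key, Matrix.det_one]
  rw [h0, map_zero] at h1
  exact zero_ne_one h1

theorem detY_ne_zero {C D : Diagram n} (h : DiagramLE C D) : detY C D h ≠ 0 :=
  Finset.prod_ne_zero_iff.2 fun j _ => minorY_ne_zero (h j)

/-- Some of the spanning products form a basis of torus eigenvectors, so the trace is a sum of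
monomials, and uniqueness identifies it with the chosen polynomial. The spanning property is kept
for locating weights. -/
theorem exists_dualCharacter_eq (D : Diagram n) :
    ∃ (κ : Type) (_ : Fintype κ) (a : κ → {C : Diagram n // DiagramLE C D}),
      (∀ C h, detY C D h ∈ Submodule.span ℂ (Set.range fun k => detY (a k).1 D (a k).2)) ∧
      dualCharacter D = ∑ k, MvPolynomial.monomial (wt (a k).1) 1 := by
  let v : {C : Diagram n // DiagramLE C D} → weylModule D := fun C =>
    ⟨detY C.1 D C.2, Submodule.subset_span ⟨C, rfl⟩⟩
  have hv : Submodule.span ℂ (Set.range v) = ⊤ := by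
    apply Submodule.map_injective_of_injective (weylModule D).injective_subtype
    rw [Submodule.map_span, ← Set.range_comp, Submodule.map_top, Submodule.range_subtype]
    rfl
  obtain ⟨κ, a, ha, hsp, hli⟩ := exists_linearIndependent' ℂ v
  have : Finite κ := Finite.of_injective a ha
  let _ := Fintype.ofFinite κ
  classical
  let b : Module.Basis κ ℂ (weylModule D) := Module.Basis.mk hli (by rw [hsp, hv])
  refine ⟨κ, inferInstance, a, fun C h => ?_, ?_⟩
  · have hmem : v ⟨C, h⟩ ∈ Submodule.span ℂ (Set.range (v ∘ a)) := by
      rw [hsp, hv]; trivial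
    have := Submodule.mem_map_of_mem (f := (weylModule D).subtype) hmem
    rw [Submodule.map_span, ← Set.range_comp] at this
    exact this
  · refine (existsUnique_dualCharacter D).unique (aeval_dualCharacter D) fun x => ?_
    rw [char, LinearMap.trace_eq_matrix_trace ℂ b, Matrix.trace, map_sum]
    refine Finset.sum_congr rfl fun k _ => ?_
    have hk : torusEnd D x⁻¹ (b k) = (∏ i, (x i : ℂ) ^ wt (a k).1 i) • b k := by
      apply Subtype.ext
      have : ((b k : weylModule D) : CY n) = detY (a k).1 D (a k).2 := by simp [b, v]
      simp only [torusEnd, LinearMap.coe_restrict_apply, AlgHom.toLinearMap_apply,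
        Submodule.coe_smul, this]
      rw [borelAct_detY]
      simp
    rw [Matrix.diag_apply, LinearMap.toMatrix_apply, hk]
    simp [MvPolynomial.aeval_monomial, Finsupp.prod_fintype]

/-- If no basis element had weight `wt C`, projection to that weight component would vanish on all
of `M_D`; yet it fixes the nonzero `detY C D`. Coefficients are sums of natural numbers, so nothing
cancels. -/
theorem wt_mem_support_dualCharacter {C D : Diagram n} (h : DiagramLE C D) :
    wt C ∈ (dualCharacter D).support := by
  classical
  obtain ⟨κ, _, a, hspan, hχ⟩ := exists_dualCharacter_eq D
  have hex : ∃ k, wt (a k).1 = wt C := by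
    by_contra! hne
    have hle : Submodule.span ℂ (Set.range fun k => detY (a k).1 D (a k).2) ≤
        LinearMap.ker (MvPolynomial.weightedHomogeneousComponent (R := ℂ) (rowWeight n) (wt C)) := by
      rw [Submodule.span_le]
      rintro _ ⟨k, rfl⟩
      exact (isWeightedHomogeneous_detY (a k).1 D (a k).2).weightedHomogeneousComponent_ne
        _ (hne k).symm
    have h0 := hle (hspan C h)
    rw [LinearMap.mem_ker,
      (isWeightedHomogeneous_detY C D h).weightedHomogeneousComponent_same] at h0
    exact detY_ne_zero h h0
  obtain ⟨k, hk⟩ := hex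
  rw [MvPolynomial.mem_support_iff, hχ, MvPolynomial.coeff_sum]
  refine (Finset.sum_pos' (fun _ _ => Nat.zero_le _) ⟨k, mem_univ k, ?_⟩).ne'
  simp [MvPolynomial.coeff_monomial, hk]

/-! ### Displacements -/

/-- The indicator function of row `i`. -/
def rowUnit (i x : Fin n) : ℤ := if x = i then 1 else 0

/-- The columns with a blank in row `i₁` above a box in row `i₂`. -/
def colsA (D : Diagram n) (i₁ i₂ : Fin n) : Finset (Fin n) :=
  univ.filter fun j => IsA D i₁ i₂ j

/-- The columns with a blank in row `i₁` and boxes in rows `i₂`, `i₃`, where `i₁ < i₂ < i₃`. -/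
def colsFull (D : Diagram n) (i₁ i₂ i₃ : Fin n) : Finset (Fin n) :=
  univ.filter fun j => i₁ < i₂ ∧ i₂ < i₃ ∧ (i₁, j) ∉ D ∧ (i₂, j) ∈ D ∧ (i₃, j) ∈ D

/-- The columns with blanks in rows `i₁`, `i₃` and a box in row `i₂`, where `i₁ < i₂ < i₃`. -/
def colsMid (D : Diagram n) (i₁ i₂ i₃ : Fin n) : Finset (Fin n) :=
  univ.filter fun j => i₁ < i₂ ∧ i₂ < i₃ ∧ (i₁, j) ∉ D ∧ (i₂, j) ∈ D ∧ (i₃, j) ∉ D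

/-- The displacements of weights that occur in the dual character. -/
noncomputable def displacements (D : Diagram n) : Finset (Fin n → ℤ) :=
  (dualCharacter D).support.image fun α i => (α i : ℤ) - wt D i

theorem card_displacements_le (D : Diagram n) : (displacements D).card ≤ theta D :=
  card_image_le

theorem RaisesTo.mem_displacements {D C : Diagram n} (h : RaisesTo D C) {d : Fin n → ℤ}
    (hd : ∀ i, (wt C i : ℤ) = wt D i + d i) : d ∈ displacements D :=
  mem_image.2 ⟨wt C, wt_mem_support_dualCharacter h.diagramLE, by ext i; rw [hd]; ring⟩

/-- The displacement of `a` single moves from row `i₂` to row `i₁`. -/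
def moveA (i₁ i₂ : Fin n) (a : ℕ) (x : Fin n) : ℤ :=
  a * (rowUnit i₁ x - rowUnit i₂ x)

theorem zero_mem_displacements (D : Diagram n) : 0 ∈ displacements D :=
  (RaisesTo.refl D).mem_displacements fun i => by simp

theorem moveA_mem_displacements (D : Diagram n) {i₁ i₂ : Fin n} {a : ℕ} (ha₀ : 1 ≤ a)
    (ha : a ≤ (colsA D i₁ i₂).card) : moveA i₁ i₂ a ∈ displacements D := by
  obtain ⟨J, hJ, rfl⟩ := exists_subset_card_eq ha
  have hA : ∀ j ∈ J, IsA D i₁ i₂ j := fun j hj => (mem_filter.1 (hJ hj)).2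
  -- A column of `J` is needed only to read off `i₁ < i₂`.
  obtain ⟨j, hj⟩ := card_pos.1 ha₀
  obtain ⟨C, hC, -, hw⟩ := exists_raisesTo_move D (hA j hj).1 J
    (fun j hj => (hA j hj).2.1) (fun j hj => (hA j hj).2.2)
  exact hC.mem_displacements hw

/-- The second move acts on the result of the first. By `hPQ`, in a column usable by both the two
moves touch different rows, so the blank and the box needed by the second are still in place. -/
theorem move_add_move_mem_displacements (D : Diagram n) {i₁ i₂ k₁ k₂ : Fin n} {a b : ℕ}
    (hi : i₁ < i₂) (hk : k₁ < k₂) {P Q : Finset (Fin n)} (ha : a ≤ P.card) (hb : b ≤ Q.card)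
    (hP : ∀ j ∈ P, (i₁, j) ∉ D ∧ (i₂, j) ∈ D) (hQ : ∀ j ∈ Q, (k₁, j) ∉ D ∧ (k₂, j) ∈ D)
    (hPQ : ∀ j ∈ P, j ∈ Q → k₁ ≠ i₁ ∧ k₁ ≠ i₂ ∧ k₂ ≠ i₁ ∧ k₂ ≠ i₂) :
    (moveA i₁ i₂ a + moveA k₁ k₂ b : Fin n → ℤ) ∈ displacements D := by
  obtain ⟨J, hJ, rfl⟩ := exists_subset_card_eq ha
  obtain ⟨K, hK, rfl⟩ := exists_subset_card_eq hb
  obtain ⟨C, hC, hCD, hw⟩ := exists_raisesTo_move D hi J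
    (fun j hj => (hP j (hJ hj)).1) (fun j hj => (hP j (hJ hj)).2)
  have h₁ : ∀ j ∈ K, (k₁, j) ∉ C := fun j hj => by
    rw [hCD k₁ j fun hjJ => ⟨(hPQ j (hJ hjJ) (hK hj)).1, (hPQ j (hJ hjJ) (hK hj)).2.1⟩]
    exact (hQ j (hK hj)).1
  have h₂ : ∀ j ∈ K, (k₂, j) ∈ C := fun j hj => by
    rw [hCD k₂ j fun hjJ => (hPQ j (hJ hjJ) (hK hj)).2.2]
    exact (hQ j (hK hj)).2
  obtain ⟨E, hE, -, hw'⟩ := exists_raisesTo_move C hk K h₁ h₂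
  refine (hC.trans hE).mem_displacements fun i => ?_
  rw [hw', hw, Pi.add_apply]
  simp only [moveA, rowUnit]
  ring

/-- The two sets of columns differ in row `i₃`, hence are disjoint, and the two moves never meet in
a column although both fill row `i₁`. -/
theorem moveB_mem_displacements (D : Diagram n) {i₁ i₂ i₃ : Fin n} {a b : ℕ}
    (h₁₂ : i₁ < i₂) (h₂₃ : i₂ < i₃)
    (ha : a ≤ (colsFull D i₁ i₂ i₃).card) (hb : b ≤ (colsMid D i₁ i₂ i₃).card) :
    (moveA i₁ i₃ a + moveA i₁ i₂ b : Fin n → ℤ) ∈ displacements D := by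
  refine move_add_move_mem_displacements D (h₁₂.trans h₂₃) h₁₂ ha hb ?_ ?_ ?_ <;>
    simp +contextual [colsFull, colsMid]

/-- The moves may share a column, but their four rows are distinct. -/
theorem moveC_mem_displacements (D : Diagram n) {i₁ i₂ i₃ i₄ : Fin n} {a b : ℕ}
    (h₁₂ : i₁ < i₂) (h₂₃ : i₂ < i₃) (h₃₄ : i₃ < i₄)
    (ha : a ≤ (colsA D i₁ i₂).card) (hb : b ≤ (colsA D i₃ i₄).card) :
    (moveA i₁ i₂ a + moveA i₃ i₄ b : Fin n → ℤ) ∈ displacements D :=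
  move_add_move_mem_displacements D h₁₂ h₃₄ ha hb
    (fun _ hj => (mem_filter.1 hj).2.2) (fun _ hj => (mem_filter.1 hj).2.2)
    fun _ _ _ => ⟨(h₁₂.trans h₂₃).ne', h₂₃.ne', (h₁₂.trans (h₂₃.trans h₃₄)).ne',
      (h₂₃.trans h₃₄).ne'⟩

/-! ### Telling the displacements apart -/

/-- The rows in which a displacement is positive, and those in which it is negative. -/
def signSets (d : Fin n → ℤ) : Finset (Fin n) × Finset (Fin n) :=
  (univ.filter fun x => 0 < d x, univ.filter fun x => d x < 0)

theorem signSets_zero : signSets (0 : Fin n → ℤ) = (∅, ∅) := by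
  simp [signSets]

theorem signSets_moveA {i₁ i₂ : Fin n} (h : i₁ < i₂) {a : ℕ} (ha : 1 ≤ a) :
    signSets (moveA i₁ i₂ a) = ({i₁}, {i₂}) := by
  have := h.ne
  ext x <;> simp only [signSets, mem_filter, mem_univ, true_and, mem_singleton] <;>
    simp only [moveA, rowUnit] <;> split_ifs <;> grind

/-- The only row shared by the two moves gains in both, so nothing cancels. -/
theorem signSets_moveB {i₁ i₂ i₃ : Fin n} (h₁₂ : i₁ < i₂) (h₂₃ : i₂ < i₃) {a b : ℕ}
    (ha : 1 ≤ a) (hb : 1 ≤ b) :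
    signSets (moveA i₁ i₃ a + moveA i₁ i₂ b) = ({i₁}, {i₂, i₃}) := by
  have := h₁₂.ne
  have := h₂₃.ne
  have := (h₁₂.trans h₂₃).ne
  ext x <;> simp only [signSets, mem_filter, mem_univ, true_and, mem_singleton, mem_insert] <;>
    simp only [moveA, rowUnit, Pi.add_apply] <;> split_ifs <;> grind

theorem signSets_moveC {i₁ i₂ i₃ i₄ : Fin n} (h₁₂ : i₁ < i₂) (h₂₃ : i₂ < i₃) (h₃₄ : i₃ < i₄)
    {a b : ℕ} (ha : 1 ≤ a) (hb : 1 ≤ b) :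
    signSets (moveA i₁ i₂ a + moveA i₃ i₄ b) = ({i₁, i₃}, {i₂, i₄}) := by
  have := h₁₂.ne
  have := h₂₃.ne
  have := h₃₄.ne
  have := (h₁₂.trans h₂₃).ne
  have := (h₂₃.trans h₃₄).ne
  have := ((h₁₂.trans h₂₃).trans h₃₄).ne
  ext x <;> simp only [signSets, mem_filter, mem_univ, true_and, mem_singleton, mem_insert] <;>
    simp only [moveA, rowUnit, Pi.add_apply] <;> split_ifs <;> grind

theorem pair_eq_pair_of_lt {a b c d : Fin n} (hab : a < b) (hcd : c < d)
    (h : ({a, b} : Finset (Fin n)) = {c, d}) : a = c ∧ b = d := by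
  have ha : a ∈ ({c, d} : Finset (Fin n)) := h ▸ by simp
  have hb : b ∈ ({c, d} : Finset (Fin n)) := h ▸ by simp
  have hc : c ∈ ({a, b} : Finset (Fin n)) := h ▸ by simp
  simp only [mem_insert, mem_singleton] at ha hb hc
  grind

/-- The parameters of the displacements from configurations (A). -/
def indexA (D : Diagram n) : Finset (Σ _ : Fin n × Fin n, ℕ) :=
  univ.sigma fun t => Icc 1 (colsA D t.1 t.2).card

/-- The parameters of the displacements from configurations (B) and (B'). -/
def indexB (D : Diagram n) : Finset (Σ _ : Fin n × Fin n × Fin n, ℕ × ℕ) :=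
  univ.sigma fun t => Icc 1 (colsFull D t.1 t.2.1 t.2.2).card ×ˢ
    Icc 1 (colsMid D t.1 t.2.1 t.2.2).card

/-- The parameters of the displacements from configurations (C), (C') and (C''). -/
def indexC (D : Diagram n) : Finset (Σ _ : Fin n × Fin n × Fin n × Fin n, ℕ × ℕ) :=
  (univ.filter fun t : Fin n × Fin n × Fin n × Fin n => t.2.1 < t.2.2.1).sigma fun t =>
    Icc 1 (colsA D t.1 t.2.1).card ×ˢ Icc 1 (colsA D t.2.2.1 t.2.2.2).card

/-- The displacement with parameters `s`, from configurations (A). -/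
def dispA (s : Σ _ : Fin n × Fin n, ℕ) : Fin n → ℤ := moveA s.1.1 s.1.2 s.2

/-- The displacement with parameters `s`, from configurations (B) and (B'). -/
def dispB (s : Σ _ : Fin n × Fin n × Fin n, ℕ × ℕ) : Fin n → ℤ :=
  moveA s.1.1 s.1.2.2 s.2.1 + moveA s.1.1 s.1.2.1 s.2.2

/-- The displacement with parameters `s`, from configurations (C), (C') and (C''). -/
def dispC (s : Σ _ : Fin n × Fin n × Fin n × Fin n, ℕ × ℕ) : Fin n → ℤ :=
  moveA s.1.1 s.1.2.1 s.2.1 + moveA s.1.2.2.1 s.1.2.2.2 s.2.2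

theorem lt_of_colsA_card_pos {D : Diagram n} {i₁ i₂ : Fin n} (h : 1 ≤ (colsA D i₁ i₂).card) :
    i₁ < i₂ := by
  obtain ⟨j, hj⟩ := card_pos.1 h
  exact (mem_filter.1 hj).2.1

theorem mem_indexA {D : Diagram n} {i₁ i₂ : Fin n} {a : ℕ} (h : ⟨(i₁, i₂), a⟩ ∈ indexA D) :
    i₁ < i₂ ∧ 1 ≤ a ∧ a ≤ (colsA D i₁ i₂).card := by
  simp only [indexA, mem_sigma, mem_univ, true_and, mem_Icc] at h
  exact ⟨lt_of_colsA_card_pos (h.1.trans h.2), h⟩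

theorem mem_indexB {D : Diagram n} {i₁ i₂ i₃ : Fin n} {a b : ℕ}
    (h : ⟨(i₁, i₂, i₃), (a, b)⟩ ∈ indexB D) :
    i₁ < i₂ ∧ i₂ < i₃ ∧ (1 ≤ a ∧ a ≤ (colsFull D i₁ i₂ i₃).card) ∧
      1 ≤ b ∧ b ≤ (colsMid D i₁ i₂ i₃).card := by
  simp only [indexB, mem_sigma, mem_univ, true_and, mem_Icc, mem_product] at h
  obtain ⟨j, hj⟩ := card_pos.1 (h.1.1.trans h.1.2)
  exact ⟨(mem_filter.1 hj).2.1, (mem_filter.1 hj).2.2.1, h⟩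

theorem mem_indexC {D : Diagram n} {i₁ i₂ i₃ i₄ : Fin n} {a b : ℕ}
    (h : ⟨(i₁, i₂, i₃, i₄), (a, b)⟩ ∈ indexC D) :
    i₁ < i₂ ∧ i₂ < i₃ ∧ i₃ < i₄ ∧ (1 ≤ a ∧ a ≤ (colsA D i₁ i₂).card) ∧
      1 ≤ b ∧ b ≤ (colsA D i₃ i₄).card := by
  simp only [indexC, mem_sigma, mem_filter, mem_univ, true_and, mem_Icc, mem_product] at h
  obtain ⟨h₂₃, ha, hb⟩ := h
  exact ⟨lt_of_colsA_card_pos (ha.1.trans ha.2), h₂₃, lt_of_colsA_card_pos (hb.1.trans hb.2),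
    ha, hb⟩

theorem dispA_injOn (D : Diagram n) : Set.InjOn (dispA (n := n)) (indexA D) := by
  rintro ⟨⟨i₁, i₂⟩, a⟩ hs ⟨⟨k₁, k₂⟩, c⟩ ht hst
  obtain ⟨hi, ha, -⟩ := mem_indexA hs
  obtain ⟨hk, hc, -⟩ := mem_indexA ht
  simp only [dispA] at hst
  have h := congrArg signSets hst
  rw [signSets_moveA hi ha, signSets_moveA hk hc] at h
  obtain ⟨rfl, rfl⟩ : i₁ = k₁ ∧ i₂ = k₂ := by simpa using h
  have h₁ := congrFun hst i₁
  simp only [moveA, rowUnit, hi.ne, if_true, if_false] at h₁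
  obtain rfl : a = c := by lia
  rfl

theorem dispB_injOn (D : Diagram n) : Set.InjOn (dispB (n := n)) (indexB D) := by
  rintro ⟨⟨i₁, i₂, i₃⟩, a, b⟩ hs ⟨⟨k₁, k₂, k₃⟩, c, d⟩ ht hst
  obtain ⟨h₁₂, h₂₃, ⟨ha, -⟩, hb, -⟩ := mem_indexB hs
  obtain ⟨k₁₂, k₂₃, ⟨hc, -⟩, hd, -⟩ := mem_indexB ht
  simp only [dispB] at hst
  have h := congrArg signSets hst
  rw [signSets_moveB h₁₂ h₂₃ ha hb, signSets_moveB k₁₂ k₂₃ hc hd, Prod.mk.injEq,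
    singleton_inj] at h
  obtain ⟨rfl, h⟩ := h
  obtain ⟨rfl, rfl⟩ := pair_eq_pair_of_lt h₂₃ k₂₃ h
  -- The rows now agree; the value at `i₂` is `-b` and the value at `i₃` is `-a`.
  have e₂ := congrFun hst i₂
  have e₃ := congrFun hst i₃
  simp only [moveA, rowUnit, Pi.add_apply, h₁₂.ne', h₂₃.ne, h₂₃.ne', (h₁₂.trans h₂₃).ne', if_true,
    if_false] at e₂ e₃
  obtain rfl : a = c := by lia
  obtain rfl : b = d := by lia
  rfl

/-- The row order makes the unordered sign sets `{i₁, i₃}` and `{i₂, i₄}` determine all four rows;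
the losses at `i₂` and `i₄` are then `a` and `b`. -/
theorem dispC_injOn (D : Diagram n) : Set.InjOn (dispC (n := n)) (indexC D) := by
  rintro ⟨⟨i₁, i₂, i₃, i₄⟩, a, b⟩ hs ⟨⟨k₁, k₂, k₃, k₄⟩, c, d⟩ ht hst
  obtain ⟨h₁₂, h₂₃, h₃₄, ⟨ha, -⟩, hb, -⟩ := mem_indexC hs
  obtain ⟨k₁₂, k₂₃, k₃₄, ⟨hc, -⟩, hd, -⟩ := mem_indexC ht
  simp only [dispC] at hst
  have h := congrArg signSets hst
  rw [signSets_moveC h₁₂ h₂₃ h₃₄ ha hb, signSets_moveC k₁₂ k₂₃ k₃₄ hc hd, Prod.mk.injEq] at h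
  obtain ⟨rfl, rfl⟩ := pair_eq_pair_of_lt (h₁₂.trans h₂₃) (k₁₂.trans k₂₃) h.1
  obtain ⟨rfl, rfl⟩ := pair_eq_pair_of_lt (h₂₃.trans h₃₄) (k₂₃.trans k₃₄) h.2
  have e₂ := congrFun hst i₂
  have e₄ := congrFun hst i₄
  simp only [moveA, rowUnit, Pi.add_apply, h₁₂.ne', h₂₃.ne, h₃₄.ne', (h₂₃.trans h₃₄).ne,
    (h₂₃.trans h₃₄).ne', (h₁₂.trans (h₂₃.trans h₃₄)).ne', if_true, if_false] at e₂ e₄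
  obtain rfl : a = c := by lia
  obtain rfl : b = d := by lia
  rfl

theorem one_add_card_index_le_card_displacements (D : Diagram n) :
    1 + (indexA D).card + (indexB D).card + (indexC D).card ≤ (displacements D).card := by
  -- This invariant separates zero and the three families.
  let κ : (Fin n → ℤ) → ℕ × ℕ := fun d => ((signSets d).1.card, (signSets d).2.card)
  have hA : ∀ d ∈ (indexA D).image dispA, d ∈ displacements D ∧ κ d = (1, 1) := by
    simp only [mem_image, forall_exists_index, and_imp]
    rintro _ ⟨⟨i₁, i₂⟩, a⟩ hs rfl
    obtain ⟨hi, ha, ha'⟩ := mem_indexA hs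
    refine ⟨moveA_mem_displacements D ha ha', ?_⟩
    simp only [κ, dispA, signSets_moveA hi ha, card_singleton]
  have hB : ∀ d ∈ (indexB D).image dispB, d ∈ displacements D ∧ κ d = (1, 2) := by
    simp only [mem_image, forall_exists_index, and_imp]
    rintro _ ⟨⟨i₁, i₂, i₃⟩, a, b⟩ hs rfl
    obtain ⟨h₁₂, h₂₃, ⟨ha, ha'⟩, hb, hb'⟩ := mem_indexB hs
    refine ⟨moveB_mem_displacements D h₁₂ h₂₃ ha' hb', ?_⟩
    simp only [κ, dispB, signSets_moveB h₁₂ h₂₃ ha hb, card_singleton, card_pair h₂₃.ne]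
  have hC : ∀ d ∈ (indexC D).image dispC, d ∈ displacements D ∧ κ d = (2, 2) := by
    simp only [mem_image, forall_exists_index, and_imp]
    rintro _ ⟨⟨i₁, i₂, i₃, i₄⟩, a, b⟩ hs rfl
    obtain ⟨h₁₂, h₂₃, h₃₄, ⟨ha, ha'⟩, hb, hb'⟩ := mem_indexC hs
    refine ⟨moveC_mem_displacements D h₁₂ h₂₃ h₃₄ ha' hb', ?_⟩
    simp only [κ, dispC, signSets_moveC h₁₂ h₂₃ h₃₄ ha hb, card_pair (h₁₂.trans h₂₃).ne,
      card_pair (h₂₃.trans h₃₄).ne]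
  have h0 : κ 0 = (0, 0) := by simp only [κ, signSets_zero, card_empty]
  have hdisj : ∀ {s t : Finset (Fin n → ℤ)} {u v : ℕ × ℕ}, u ≠ v → (∀ d ∈ s, κ d = u) →
      (∀ d ∈ t, κ d = v) → Disjoint s t := fun huv hs ht =>
    disjoint_left.2 fun d hd hd' => huv ((hs d hd).symm.trans (ht d hd'))
  have hZ : ∀ d ∈ ({0} : Finset (Fin n → ℤ)), κ d = (0, 0) := by simpa using h0
  have hA' := fun d hd => (hA d hd).2
  have hB' := fun d hd => (hB d hd).2
  have hC' := fun d hd => (hC d hd).2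
  rw [← card_image_of_injOn (dispA_injOn D), ← card_image_of_injOn (dispB_injOn D),
    ← card_image_of_injOn (dispC_injOn D), ← card_singleton (0 : Fin n → ℤ),
    ← card_union_of_disjoint (hdisj (by decide) hZ hA'), ← card_union_of_disjoint,
    ← card_union_of_disjoint]
  · refine card_le_card (union_subset (union_subset (union_subset ?_ ?_) ?_) ?_)
    · simpa using zero_mem_displacements D
    · exact fun d hd => (hA d hd).1
    · exact fun d hd => (hB d hd).1
    · exact fun d hd => (hC d hd).1
  · exact disjoint_union_left.2 ⟨disjoint_union_left.2 ⟨hdisj (by decide) hZ hC',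
      hdisj (by decide) hA' hC'⟩, hdisj (by decide) hB' hC'⟩
  · exact disjoint_union_left.2 ⟨hdisj (by decide) hZ hB', hdisj (by decide) hA' hB'⟩

/-! ### Counting configurations by rows -/

theorem card_indexA (D : Diagram n) : (indexA D).card = r₁ D := by
  simp only [indexA, card_sigma, Nat.card_Icc, Nat.add_sub_cancel, r₁, colsA, card_filter,
    Fintype.sum_prod_type]

/-- For fixed rows the right side counts pairs of a full column and a mid column. Such a pair is a
(B) if the full column is on the left and a (B') if it is on the right, never both. -/
theorem r₂_le_card_indexB (D : Diagram n) : r₂ D ≤ (indexB D).card := by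
  simp only [indexB, card_sigma, card_product, Nat.card_Icc, Nat.add_sub_cancel, r₂, colsFull,
    colsMid, card_filter, Fintype.sum_prod_type, ← sum_add_distrib]
  refine sum_le_sum fun i₁ _ => sum_le_sum fun i₂ _ => sum_le_sum fun i₃ _ => ?_
  simp only [sum_add_distrib]
  -- Swapping the sums for (B') makes `j₁` the full column in both counts.
  rw [sum_mul_sum, sum_comm (f := fun j₁ j₂ => if IsB' D i₁ i₂ i₃ j₁ j₂ then 1 else 0),
    ← sum_add_distrib]
  refine sum_le_sum fun j₁ _ => ?_
  rw [← sum_add_distrib]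
  refine sum_le_sum fun j₂ _ => ?_
  have hB : IsB D i₁ i₂ i₃ j₁ j₂ → (i₁ < i₂ ∧ i₂ < i₃ ∧ (i₁, j₁) ∉ D ∧ (i₂, j₁) ∈ D ∧
      (i₃, j₁) ∈ D) ∧ (i₁ < i₂ ∧ i₂ < i₃ ∧ (i₁, j₂) ∉ D ∧ (i₂, j₂) ∈ D ∧ (i₃, j₂) ∉ D) ∧
      j₁ < j₂ := by unfold IsB; tauto
  have hB' : IsB' D i₁ i₂ i₃ j₂ j₁ → (i₁ < i₂ ∧ i₂ < i₃ ∧ (i₁, j₁) ∉ D ∧ (i₂, j₁) ∈ D ∧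
      (i₃, j₁) ∈ D) ∧ (i₁ < i₂ ∧ i₂ < i₃ ∧ (i₁, j₂) ∉ D ∧ (i₂, j₂) ∈ D ∧ (i₃, j₂) ∉ D) ∧
      j₂ < j₁ := by unfold IsB'; tauto
  by_cases b : IsB D i₁ i₂ i₃ j₁ j₂
  · have nb : ¬ IsB' D i₁ i₂ i₃ j₂ j₁ := fun b' => (hB b).2.2.asymm (hB' b').2.2
    rw [if_pos b, if_neg nb, if_pos (hB b).1, if_pos (hB b).2.1, add_zero, one_mul]
  · by_cases b' : IsB' D i₁ i₂ i₃ j₂ j₁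
    · rw [if_neg b, if_pos b', if_pos (hB' b').1, if_pos (hB' b').2.1, zero_add, one_mul]
    · rw [if_neg b, if_neg b']
      exact Nat.zero_le _

theorem r₃_le_card_indexC (D : Diagram n) : r₃ D ≤ (indexC D).card := by
  simp only [indexC, card_sigma, card_product, Nat.card_Icc, Nat.add_sub_cancel, r₃, colsA,
    card_filter, sum_filter, Fintype.sum_prod_type, ← sum_add_distrib]
  refine sum_le_sum fun i₁ _ => sum_le_sum fun i₂ _ => sum_le_sum fun i₃ _ =>
    sum_le_sum fun i₄ _ => ?_
  simp only [sum_add_distrib]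
  -- The one-column configurations become the diagonal of a double sum. With the sums for (C')
  -- swapped, `j₁` always carries rows `i₁, i₂` and `j₂` rows `i₃, i₄`.
  have hdiag : ∀ j₁, (if IsC'' D i₁ i₂ i₃ i₄ j₁ then 1 else 0) =
      ∑ j₂, if j₁ = j₂ then (if IsC'' D i₁ i₂ i₃ i₄ j₁ then 1 else 0) else 0 := by simp
  rw [sum_mul_sum, sum_comm (f := fun j₁ j₂ => if IsC' D i₁ i₂ i₃ i₄ j₁ j₂ then 1 else 0),
    sum_congr rfl fun j₁ _ => hdiag j₁, ← sum_add_distrib, ← sum_add_distrib]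
  split_ifs with h₂₃
  · refine sum_le_sum fun j₁ _ => ?_
    rw [← sum_add_distrib, ← sum_add_distrib]
    refine sum_le_sum fun j₂ _ => ?_
    have hC : IsC D i₁ i₂ i₃ i₄ j₁ j₂ → IsA D i₁ i₂ j₁ ∧ IsA D i₃ i₄ j₂ ∧ j₁ < j₂ := by
      unfold IsC IsA; tauto
    have hC' : IsC' D i₁ i₂ i₃ i₄ j₂ j₁ → IsA D i₁ i₂ j₁ ∧ IsA D i₃ i₄ j₂ ∧ j₂ < j₁ := by
      unfold IsC' IsA; tauto
    have hC'' : IsC'' D i₁ i₂ i₃ i₄ j₁ → IsA D i₁ i₂ j₁ ∧ IsA D i₃ i₄ j₁ := by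
      unfold IsC'' IsA; tauto
    -- The three indicators require `j₁ < j₂`, `j₂ < j₁` and `j₁ = j₂` respectively, so at most one
    -- is 1.
    grind
  · refine (sum_eq_zero fun j₁ _ => ?_).le.trans (Nat.zero_le _)
    have hC : ∀ j₂, ¬ IsC' D i₁ i₂ i₃ i₄ j₂ j₁ := fun j₂ h => h₂₃ h.2.1
    have : ∀ j₂, ¬ IsC D i₁ i₂ i₃ i₄ j₁ j₂ := fun j₂ h => h₂₃ h.2.1
    have hC'' : ¬ IsC'' D i₁ i₂ i₃ i₄ j₁ := fun h => h₂₃ h.2.1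
    simp [*]

end FlaggedWeyl

theorem mainTheorem1 (n : ℕ) (D : FlaggedWeyl.Diagram n) :
    FlaggedWeyl.theta D ≥ 1 + FlaggedWeyl.r₁ D + FlaggedWeyl.r₂ D + FlaggedWeyl.r₃ D := by
  have h₁ := FlaggedWeyl.card_indexA D
  have h₂ := FlaggedWeyl.r₂_le_card_indexB D
  have h₃ := FlaggedWeyl.r₃_le_card_indexC D
  have h₄ := FlaggedWeyl.one_add_card_index_le_card_displacements D
  have h₅ := FlaggedWeyl.card_displacements_le D
  lia
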